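/- **Setting.** Let $d \ge 0$ and $g_0(x) = e^{-\pi |x|^2}$ on $\mathbb{R}^d$. For $t,s \in \mathbb{R}^d$ put $T_t f(x) = f(x-t)$, $M_s f(x) = e^{2\pi i s\cdot x} f(x)$, and $V_{g_0} f(t,s) = \int_{\mathbb{R}^d} f(x)\,\overline{M_s T_t g_0(x)}\,dx$. Let $S_0(\mathbb{R}^d)$ be Feichtinger's algebra: the space of all continuous $f \in L^2(\mathbb{R}^d)$ with $V_{g_0} f \in L^1(\mathbb{R}^{2d})$, with the norm $\|f\|_{S_0} = \|V_{g_0} f\|_{L^1(\mathbb{R}^{2d})}$. Its continuous dual $S_0'(\mathbb{R}^d)$ is the space of mild distributions. The support $\operatorname{supp}(\sigma)$ of $\sigma \in S_0'(\mathbb{R}^d)$ is the complement of the set of points $z \in \mathbb{R}^d$ for which there is a $\delta > 0$ such that $\sigma(k) = 0$ for all $k \in S_0(\mathbb{R}^d)$ with $\operatorname{supp}(k) \subseteq B_\delta(z)$. A lattice is a discrete cocompact subgroup of $\mathbb{R}^d$, and $\delta_\lambda(f) = f(\lambda)$. **Proposition.** Let $\Lambda$ be a lattice in $\mathbb{R}^d$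 and let $\sigma \in S_0'(\mathbb{R}^d)$. Then $\operatorname{supp}(\sigma) \subseteq \Lambda$ if and only if there is a bounded family $(c_\lambda)_{\lambda \in \Lambda}$ of complex numbers such that $\sigma = \sum_{\lambda \in \Lambda} c_\lambda \delta_\lambda$, with unconditional weak-$*$ convergence, i.e. $\sigma(f) = \sum_{\lambda \in \Lambda} c_\lambda f(\lambda)$ unconditionally for every $f \in S_0(\mathbb{R}^d)$. -/

import Mathlib

open MeasureTheory Complex

noncomputable section

namespace Mild

/-- The Euclidean space `ℝ^d`. -/
abbrev Rd (d : ℕ) : Type := EuclideanSpace ℝ (Fin d)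

/-- Translation `T_t f (x) = f (x - t)`. -/
def translation {d : ℕ} (t : Rd d) (f : Rd d → ℂ) : Rd d → ℂ :=
  fun x => f (x - t)

/-- Modulation `M_s f (x) = exp (2 π i s · x) f (x)`. -/
def modulation {d : ℕ} (s : Rd d) (f : Rd d → ℂ) : Rd d → ℂ :=
  fun x => Complex.exp (2 * Real.pi * Complex.I * ((inner ℝ s x : ℝ) : ℂ)) * f x

/-- The standard Gaussian `g₀ (t) = exp (-π |t|²)`. -/
def gaussian (d : ℕ) : Rd d → ℂ :=
  fun t => ((Real.exp (-Real.pi * ‖t‖ ^ 2) : ℝ) : ℂ)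

/-- The short-time Fourier transform `V_g f (t, s) = ⟨f, M_s T_t g⟩` at `p = (t, s)`, where
`⟨f, h⟩ = ∫ f (x) conj (h (x)) dx`. -/
def stft {d : ℕ} (g f : Rd d → ℂ) (p : Rd d × Rd d) : ℂ :=
  ∫ x, f x * (starRingEnd ℂ) (modulation p.2 (translation p.1 g) x)

lemma norm_modulation {d : ℕ} (s : Rd d) (f : Rd d → ℂ) (x : Rd d) :
    ‖modulation s f x‖ = ‖f x‖ := by
  have : (2 * Real.pi * Complex.I * ((inner ℝ s x : ℝ) : ℂ))
      = ((2 * Real.pi * inner ℝ s x : ℝ) : ℂ) * Complex.I := by push_cast; ring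
  rw [modulation, norm_mul, this, Complex.norm_exp_ofReal_mul_I, one_mul]

lemma continuous_gaussian (d : ℕ) : Continuous (gaussian d) := by
  unfold gaussian; fun_prop

lemma continuous_shift {d : ℕ} (p : Rd d × Rd d) :
    Continuous (modulation p.2 (translation p.1 (gaussian d))) := by
  have := continuous_gaussian d
  unfold modulation translation
  fun_prop

lemma memLp_shift {d : ℕ} (p : Rd d × Rd d) :
    MemLp (modulation p.2 (translation p.1 (gaussian d))) 2 volume := by
  rw [memLp_two_iff_integrable_sq_norm (continuous_shift p).aestronglyMeasurable]
  have h := (GaussianFourier.integrable_cexp_neg_mul_sq_norm_add (V := Rd d)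
    (b := (2 * Real.pi : ℂ)) (by simp [Real.pi_pos]) 0 0).norm.comp_sub_right p.1
  refine h.congr (Filter.Eventually.of_forall fun x => ?_)
  simp only [norm_modulation, translation, gaussian, Complex.norm_real, Real.norm_eq_abs,
    Real.abs_exp, Complex.norm_exp]
  rw [← Real.exp_nat_mul]
  congr 1
  simp [← Complex.ofReal_pow]
  ring

lemma integrable_stft_integrand {d : ℕ} {f : Rd d → ℂ} (hf : MemLp f 2 volume)
    (p : Rd d × Rd d) :
    Integrable fun x =>
      f x * (starRingEnd ℂ) (modulation p.2 (translation p.1 (gaussian d)) x) :=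
  hf.integrable_mul (memLp_shift p).star

lemma stft_add {d : ℕ} {f h : Rd d → ℂ} (hf : MemLp f 2 volume) (hh : MemLp h 2 volume) :
    stft (gaussian d) (f + h) = stft (gaussian d) f + stft (gaussian d) h := by
  funext p
  simp only [stft, Pi.add_apply, add_mul]
  exact integral_add (integrable_stft_integrand hf p) (integrable_stft_integrand hh p)

lemma stft_smul {d : ℕ} (g : Rd d → ℂ) (a : ℂ) (f : Rd d → ℂ) :
    stft g (a • f) = a • stft g f := by
  funext p
  simp only [stft, Pi.smul_apply, smul_eq_mul, mul_assoc]
  exact integral_const_mul _ _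

/-- The functions in `S₀(ℝ^d)`: the `f ∈ L²(ℝ^d)` with `V_{g₀} f ∈ L¹(ℝ^{2d})`. Such an `L²`-class
has exactly one continuous representative, and the elements are these representatives. -/
def s0Submodule (d : ℕ) : Submodule ℂ (Rd d → ℂ) where
  carrier := {f | Continuous f ∧ MemLp f 2 volume ∧ Integrable (stft (gaussian d) f) volume}
  add_mem' := by
    rintro f h ⟨hf, hf2, hf1⟩ ⟨hh, hh2, hh1⟩
    exact ⟨hf.add hh, hf2.add hh2, by rw [stft_add hf2 hh2]; exact hf1.add hh1⟩
  zero_mem' := by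
    refine ⟨continuous_zero, MemLp.zero, ?_⟩
    have : stft (gaussian d) 0 = 0 := by funext p; simp [stft]
    rw [this]
    exact integrable_zero _ _ _
  smul_mem' := by
    rintro a f ⟨hf, hf2, hf1⟩
    exact ⟨hf.const_smul a, hf2.const_smul a, by rw [stft_smul]; exact hf1.smul a⟩

/-- Feichtinger's algebra `S₀(ℝ^d)`. This is a separate type (and not the submodule), because its
topology is that of the norm below and not that of pointwise convergence. -/
def S0 (d : ℕ) : Type := ↥(s0Submodule d)

instance (d : ℕ) : AddCommGroup (S0 d) := inferInstanceAs (AddCommGroup ↥(s0Submodule d))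

instance (d : ℕ) : Module ℂ (S0 d) := inferInstanceAs (Module ℂ ↥(s0Submodule d))

instance (d : ℕ) : CoeFun (S0 d) (fun _ => Rd d → ℂ) := ⟨fun f => Subtype.val f⟩

/-- Definiteness of the norm below: `V_{g₀} f = 0` almost everywhere forces `f = 0`. -/
lemma eq_zero_of_stft {d : ℕ} (f : S0 d) (h : stft (gaussian d) f =ᵐ[volume] 0) : f = 0 := by
  have hf : Continuous f := f.2.1
  have hf2 : MemLp f 2 volume := f.2.2.1
  rw [Measure.volume_eq_prod] at h
  obtain ⟨t, ht⟩ := (Measure.ae_ae_of_ae_prod h).exists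
  let k : Rd d → ℂ := fun x => f x * (starRingEnd ℂ) (translation t (gaussian d) x)
  have hg := continuous_gaussian d
  have hk : Continuous k := by
    have : Continuous (translation t (gaussian d)) := by unfold translation; fun_prop
    exact hf.mul (Complex.continuous_conj.comp this)
  have hki : Integrable k := by
    have := integrable_stft_integrand hf2 (t, 0)
    simpa [modulation, k] using this
  have hF : FourierTransform.fourier k =ᵐ[volume] 0 := by
    filter_upwards [ht] with s hs
    refine Eq.trans ?_ hs
    rw [Real.fourier_eq']
    refine integral_congr_ae (Filter.Eventually.of_forall fun x => ?_)
    simp only [k, modulation, map_mul, ← Complex.exp_conj, smul_eq_mul, Complex.conj_ofReal,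
      Complex.conj_I, Complex.ofReal_mul, Complex.ofReal_neg, Complex.ofReal_ofNat, map_ofNat,
      real_inner_comm]
    ring_nf
  have hinv := hk.fourierInv_fourier_eq hki ((integrable_zero _ _ _).congr hF.symm)
  have hk0 : k = 0 := by
    rw [← hinv]
    funext x
    rw [Real.fourierInv_eq']
    exact integral_eq_zero_of_ae (by filter_upwards [hF] with s hs; simp [hs])
  refine Subtype.ext (funext fun x => ?_)
  change f x = 0
  have := congrFun hk0 x
  simpa [k, translation, gaussian] using this

/-- The norm `‖f‖ = ∫ |V_{g₀} f (t, s)| d(t, s)` of `S₀(ℝ^d)`. -/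
def s0Norm (d : ℕ) : AddGroupNorm (S0 d) where
  toFun f := ∫ p, ‖stft (gaussian d) f p‖
  map_zero' := by
    have : stft (gaussian d) (0 : S0 d) = 0 := by
      funext p
      exact integral_eq_zero_of_ae (Filter.Eventually.of_forall fun x => zero_mul _)
    rw [this]; simp
  add_le' f h := by
    have e : stft (gaussian d) (f + h : S0 d) = stft (gaussian d) f + stft (gaussian d) h :=
      stft_add f.2.2.1 h.2.2.1
    rw [e, ← integral_add f.2.2.2.norm h.2.2.2.norm]
    exact integral_mono (f.2.2.2.add h.2.2.2).norm (f.2.2.2.norm.add h.2.2.2.norm)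
      fun p => norm_add_le _ _
  neg' f := by
    have e : stft (gaussian d) (-f : S0 d) = (-1 : ℂ) • stft (gaussian d) f := by
      rw [← stft_smul, neg_one_smul]; rfl
    rw [e]; simp
  eq_zero_of_map_eq_zero' f h := by
    refine eq_zero_of_stft f ?_
    have := (integral_eq_zero_iff_of_nonneg (fun p => norm_nonneg _) f.2.2.2.norm).1 h
    filter_upwards [this] with p hp
    simpa using hp

instance (d : ℕ) : NormedAddCommGroup (S0 d) := (s0Norm d).toNormedAddCommGroup

instance (d : ℕ) : NormedSpace ℂ (S0 d) where
  norm_smul_le a f := by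
    change ∫ p, ‖stft (gaussian d) (a • f : S0 d) p‖ ≤ ‖a‖ * ∫ p, ‖stft (gaussian d) f p‖
    have e : stft (gaussian d) (a • f : S0 d) = a • stft (gaussian d) f := stft_smul _ a _
    rw [e, ← integral_const_mul]
    simp

/-- The space `S₀'(ℝ^d)` of mild distributions: the continuous dual of `S₀(ℝ^d)`. -/
abbrev MildDistribution (d : ℕ) : Type := S0 d →L[ℂ] ℂ

/-- `z` is a point of (locally) trivial action of `σ`: for some ball `B_δ(z)` one has `σ (k) = 0`
for all `k ∈ S₀(ℝ^d)` with `supp k ⊆ B_δ(z)`. -/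
def IsTrivialActionPoint {d : ℕ} (σ : MildDistribution d) (z : Rd d) : Prop :=
  ∃ δ > 0, ∀ k : S0 d, tsupport k ⊆ Metric.ball z δ → σ k = 0

/-- The support of a mild distribution: the complement of the set of points of trivial action. -/
def supp {d : ℕ} (σ : MildDistribution d) : Set (Rd d) :=
  {z | IsTrivialActionPoint σ z}ᶜ

/-- `σ = ∑_{λ ∈ Λ} c_λ δ_λ`, where `δ_λ (f) = f (λ)`, with (unconditional) weak-* convergence in
`S₀'(ℝ^d)`, that is, convergence on each `f ∈ S₀(ℝ^d)`. -/
def IsWeightedDiracComb {d : ℕ} (Λ : Submodule ℤ (Rd d)) (c : Λ → ℂ)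
    (σ : MildDistribution d) : Prop :=
  ∀ f : S0 d, HasSum (fun l : Λ => c l * f (l : Rd d)) (σ f)

end Mild

end

noncomputable section

namespace Mild

open Filter Topology FourierTransform

variable {d : ℕ}

/-! A comb on the closed set Λ acts trivially off Λ, so the content is the converse: a σ supported
on Λ sees only the values f(λ), and no derivatives of point masses occur. The reason is that points
are sets of spectral synthesis for S₀: if f(z) = 0, then f agrees near z with functions of
arbitrarily small norm (`S0.exists_small_eventuallyEq`). For z = 0, choose t such that F = V f(t, ·)
is integrable with inverse transform f · g₀(· - t); then f(0) = 0 says ∫ F = 0. Against a bump h_c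
shrinking with c, this gives k = ∫ F(ξ) (M_ξ h_c - h_c) dξ, and ‖M_ξ h_c - h_c‖ is at most a
constant times ‖T_{cξ} φ̂ - φ̂‖₁, which tends to 0 with c.

With a partition of unity it follows that σ kills every compactly supported f vanishing on Λ
(`apply_eq_zero_of_vanish_on_lattice`). Applied to f - ∑ f(λ) T_λ φ, where the bump φ is 1 at 0 and
0 at the other lattice points, this yields c_λ = σ(T_λ φ), which is bounded since translations are
isometries. Sampling on Λ is bounded from S₀ to ℓ¹ (`S0.exists_sum_norm_apply_le`), so the comb
converges absolutely and is continuous in f, and density of compactly supported functions gives the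
identity on all of S₀. -/

instance isAddHaarMeasure_volume_prod :
    (volume : Measure (Rd d × Rd d)).IsAddHaarMeasure :=
  inferInstanceAs (Measure.IsAddHaarMeasure ((volume : Measure (Rd d)).prod volume))

/-- The function `x ↦ (𝓕⁻ F) (c x) h x`. -/
def fourierInvMul (F : Rd d → ℂ) (c : ℝ) (h : Rd d → ℂ) : Rd d → ℂ :=
  fun x => 𝓕⁻ F (c • x) * h x

/-! ### Elementary structure of S₀ -/

namespace S0

@[ext] lemma ext {f h : S0 d} (H : ∀ x, f x = h x) : f = h := Subtype.ext (funext H)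

lemma norm_def (f : S0 d) : ‖f‖ = ∫ p, ‖stft (gaussian d) f p‖ := rfl

lemma continuous (f : S0 d) : Continuous f := f.2.1

lemma memLp (f : S0 d) : MemLp f 2 volume := f.2.2.1

lemma integrable_stft (f : S0 d) : Integrable (stft (gaussian d) f) volume := f.2.2.2

@[simp] lemma sub_apply (f h : S0 d) (x : Rd d) : (f - h) x = f x - h x := rfl
@[simp] lemma zero_apply (x : Rd d) : (0 : S0 d) x = 0 := rfl
@[simp] lemma smul_apply (a : ℂ) (f : S0 d) (x : Rd d) : (a • f) x = a * f x := rfl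

/-- Evaluation at a point. -/
def eval (x : Rd d) : S0 d →ₗ[ℂ] ℂ where
  toFun f := f x
  map_add' _ _ := rfl
  map_smul' _ _ := rfl

@[simp] lemma sum_apply {ι : Type*} (s : Finset ι) (f : ι → S0 d) (x : Rd d) :
    (∑ i ∈ s, f i) x = ∑ i ∈ s, f i x :=
  map_sum (eval x) f s

lemma stft_sub_smul (f h : S0 d) (a : ℂ) (p : Rd d × Rd d) :
    stft (gaussian d) (f - a • h : S0 d) p
      = stft (gaussian d) f p - a * stft (gaussian d) h p := by
  have e : stft (gaussian d) (f + (-a) • h : S0 d) =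
      stft (gaussian d) f + stft (gaussian d) ((-a) • h : S0 d) :=
    stft_add f.memLp ((-a) • h : S0 d).memLp
  have e' : stft (gaussian d) ((-a) • h : S0 d) = (-a) • stft (gaussian d) h := stft_smul _ _ _
  have : f - a • h = f + (-a) • h := by rw [neg_smul, sub_eq_add_neg]
  rw [this, e, e']
  simp [sub_eq_add_neg]

end S0

/-! ### Time-frequency shifts are isometries of S₀ -/

lemma conj_modulation (s : Rd d) (g : Rd d → ℂ) (x : Rd d) :
    (starRingEnd ℂ) (modulation s g x)
      = Complex.exp (-(2 * Real.pi * Complex.I * ((inner ℝ s x : ℝ) : ℂ)))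
        * (starRingEnd ℂ) (g x) := by
  simp only [modulation, map_mul, ← Complex.exp_conj, Complex.conj_ofReal, Complex.conj_I,
    map_ofNat]
  congr 2
  ring

lemma stft_modulation (g h : Rd d → ℂ) (ξ : Rd d) (p : Rd d × Rd d) :
    stft g (modulation ξ h) p = stft g h (p - (0, ξ)) := by
  unfold stft
  congr 1
  funext x
  have e : Complex.exp (-(2 * Real.pi * Complex.I * ((inner ℝ (p.2 - ξ) x : ℝ) : ℂ)))
      = Complex.exp (2 * Real.pi * Complex.I * ((inner ℝ ξ x : ℝ) : ℂ))
        * Complex.exp (-(2 * Real.pi * Complex.I * ((inner ℝ p.2 x : ℝ) : ℂ))) := by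
    rw [← Complex.exp_add, inner_sub_left]
    push_cast
    ring_nf
  simp only [conj_modulation, Prod.fst_sub, Prod.snd_sub, sub_zero, e]
  simp only [modulation]
  ring

lemma stft_translation (g h : Rd d → ℂ) (t : Rd d) (p : Rd d × Rd d) :
    stft g (translation t h) p
      = Complex.exp (-(2 * Real.pi * Complex.I * ((inner ℝ p.2 t : ℝ) : ℂ)))
        * stft g h (p - (t, 0)) := by
  unfold stft
  rw [← integral_const_mul, ← integral_add_right_eq_self _ t]
  congr 1
  funext x
  have e : Complex.exp (-(2 * Real.pi * Complex.I * ((inner ℝ p.2 (x + t) : ℝ) : ℂ)))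
      = Complex.exp (-(2 * Real.pi * Complex.I * ((inner ℝ p.2 t : ℝ) : ℂ)))
        * Complex.exp (-(2 * Real.pi * Complex.I * ((inner ℝ p.2 x : ℝ) : ℂ))) := by
    rw [← Complex.exp_add, inner_add_right]
    push_cast
    ring_nf
  have e' : x - (p.1 - t) = x + t - p.1 := by abel
  simp only [conj_modulation, Prod.fst_sub, Prod.snd_sub, sub_zero, e, translation,
    add_sub_cancel_right, e']
  ring

lemma continuous_modulation {h : Rd d → ℂ} (hh : Continuous h) (ξ : Rd d) :
    Continuous (modulation ξ h) := by
  unfold modulation; fun_prop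

lemma memLp_modulation {h : Rd d → ℂ} (hh : Continuous h) (h2 : MemLp h 2 volume) (ξ : Rd d) :
    MemLp (modulation ξ h) 2 volume :=
  h2.of_le (continuous_modulation hh ξ).aestronglyMeasurable
    (Eventually.of_forall fun x => (norm_modulation ξ h x).le)

namespace S0

/-- Modulation on `S₀(ℝ^d)`. -/
def modulate (ξ : Rd d) (h : S0 d) : S0 d :=
  ⟨modulation ξ h, continuous_modulation h.continuous ξ,
    memLp_modulation h.continuous h.memLp ξ, by
      have : stft (gaussian d) (modulation ξ h) = fun p => stft (gaussian d) h (p - (0, ξ)) :=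
        funext fun p => stft_modulation _ _ _ _
      rw [this]
      exact h.integrable_stft.comp_sub_right _⟩

@[simp] lemma modulate_apply (ξ : Rd d) (h : S0 d) (x : Rd d) :
    modulate ξ h x = modulation ξ h x := rfl

@[simp] lemma norm_modulate (ξ : Rd d) (h : S0 d) : ‖modulate ξ h‖ = ‖h‖ := by
  rw [norm_def, norm_def,
    ← integral_sub_right_eq_self (fun p => ‖stft (gaussian d) h p‖) ((0, ξ) : Rd d × Rd d)]
  congr 1
  funext p
  exact congrArg _ (stft_modulation _ _ _ _)

lemma norm_modulate_sub_smul (ξ : Rd d) (h : S0 d) (a : ℂ) :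
    ‖modulate ξ h - a • h‖
      = ∫ p, ‖stft (gaussian d) h (p - (0, ξ)) - a * stft (gaussian d) h p‖ := by
  rw [norm_def]
  congr 1
  funext p
  rw [stft_sub_smul, ← stft_modulation]
  rfl

/-- Translation on `S₀(ℝ^d)`. -/
def translate (t : Rd d) (h : S0 d) : S0 d :=
  ⟨translation t h, h.continuous.comp (continuous_id.sub continuous_const),
    h.memLp.comp_measurePreserving (measurePreserving_sub_right volume t), by
      have : stft (gaussian d) (translation t h) = fun p =>
          Complex.exp (((-(2 * Real.pi * inner ℝ p.2 t) : ℝ) : ℂ) * Complex.I)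
            * stft (gaussian d) h (p - (t, 0)) := by
        funext p
        rw [stft_translation]
        congr 2
        push_cast
        ring
      rw [this]
      refine (h.integrable_stft.comp_sub_right ((t, 0) : Rd d × Rd d)).bdd_mul (c := 1) ?_ ?_
      · exact Continuous.aestronglyMeasurable (by fun_prop)
      · exact Eventually.of_forall fun p => (Complex.norm_exp_ofReal_mul_I _).le⟩

@[simp] lemma translate_apply (t : Rd d) (h : S0 d) (x : Rd d) :
    translate t h x = h (x - t) := rfl

@[simp] lemma norm_translate (t : Rd d) (h : S0 d) : ‖translate t h‖ = ‖h‖ := by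
  rw [norm_def, norm_def,
    ← integral_sub_right_eq_self (fun p => ‖stft (gaussian d) h p‖) ((t, 0) : Rd d × Rd d)]
  congr 1
  funext p
  have e : -(2 * Real.pi * Complex.I * ((inner ℝ p.2 t : ℝ) : ℂ))
      = ((-(2 * Real.pi * inner ℝ p.2 t) : ℝ) : ℂ) * Complex.I := by push_cast; ring
  change ‖stft (gaussian d) (translation t h) p‖ = _
  rw [stft_translation, norm_mul, e, Complex.norm_exp_ofReal_mul_I, one_mul]

end S0

/-! ### Multiplication by inverse Fourier transforms of integrable functions -/

lemma continuous_fourierInv {F : Rd d → ℂ} (hF : Integrable F) : Continuous (𝓕⁻ F) :=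
  VectorFourier.fourierIntegral_continuous Real.continuous_fourierChar
    (by exact (continuous_inner.neg)) hF

lemma norm_fourierInv_le (F : Rd d → ℂ) (x : Rd d) : ‖𝓕⁻ F x‖ ≤ ∫ ξ, ‖F ξ‖ := by
  rw [Real.fourierInv_eq']
  refine (norm_integral_le_integral_norm _).trans (le_of_eq ?_)
  simp only [norm_smul, Complex.norm_exp_ofReal_mul_I, one_mul]

lemma continuous_fourierInvMul {F : Rd d → ℂ} (hF : Integrable F) (c : ℝ) {h : Rd d → ℂ}
    (hh : Continuous h) : Continuous (fourierInvMul F c h) :=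
  ((continuous_fourierInv hF).comp (continuous_const_smul c)).mul hh

lemma memLp_fourierInvMul {F : Rd d → ℂ} (hF : Integrable F) (c : ℝ) {h : Rd d → ℂ}
    (hh : Continuous h) (h2 : MemLp h 2 volume) : MemLp (fourierInvMul F c h) 2 volume :=
  h2.of_le_mul (c := ∫ ξ, ‖F ξ‖) (continuous_fourierInvMul hF c hh).aestronglyMeasurable
    (Eventually.of_forall fun x => by
      rw [fourierInvMul, norm_mul]
      exact mul_le_mul_of_nonneg_right (norm_fourierInv_le _ _) (norm_nonneg _))

/-- The product is the superposition ∫ F(ξ) M_{cξ} h dξ, and a modulation only shifts the frequency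
variable of the transform. -/
lemma stft_fourierInvMul {F : Rd d → ℂ} (hF : Integrable F) (c : ℝ) {h : Rd d → ℂ}
    (h2 : MemLp h 2 volume) (p : Rd d × Rd d) :
    stft (gaussian d) (fourierInvMul F c h) p
      = ∫ ξ, F ξ * stft (gaussian d) h (p - (0, c • ξ)) := by
  simp_rw [← stft_modulation]
  simp only [stft, ← integral_const_mul]
  rw [integral_integral_swap]
  · congr 1
    funext x
    rw [fourierInvMul, Real.fourierInv_eq', mul_assoc, ← integral_mul_const]
    congr 1
    funext ξ
    have e : ((2 * Real.pi * inner ℝ ξ (c • x) : ℝ) : ℂ) * Complex.I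
        = 2 * Real.pi * Complex.I * ((inner ℝ (c • ξ) x : ℝ) : ℂ) := by
      rw [real_inner_smul_left, real_inner_smul_right]; push_cast; ring
    rw [e, smul_eq_mul]
    simp only [modulation]
    ring
  · have h1 := (hF.mul_prod (integrable_stft_integrand h2 p)).bdd_mul (c := 1)
      (f := fun q : Rd d × Rd d =>
        Complex.exp (((2 * Real.pi * inner ℝ (c • q.1) q.2 : ℝ) : ℂ) * Complex.I))
      (Continuous.aestronglyMeasurable (by fun_prop))
      (Eventually.of_forall fun p => (Complex.norm_exp_ofReal_mul_I _).le)
    refine h1.congr (Eventually.of_forall fun q => ?_)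
    have e : ((2 * Real.pi * inner ℝ (c • q.1) q.2 : ℝ) : ℂ) * Complex.I
        = 2 * Real.pi * Complex.I * ((inner ℝ (c • q.1) q.2 : ℝ) : ℂ) := by push_cast; ring
    simp only [Function.uncurry, e]
    simp only [modulation]
    ring

lemma integrable_mul_stft_sub {F : Rd d → ℂ} (hF : Integrable F) (c : ℝ) (h : S0 d) :
    Integrable (fun q : Rd d × (Rd d × Rd d) =>
      F q.1 * stft (gaussian d) h (q.2 - (0, c • q.1))) (volume.prod volume) := by
  -- The integrand is a tensor product composed with a measure-preserving shear.
  have hmp : MeasurePreserving (fun q : Rd d × (Rd d × Rd d) => (q.1, q.2 - (0, c • q.1)))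
      (volume.prod volume) (volume.prod volume) :=
    (MeasurePreserving.id volume).skew_product (g := fun ξ p => p - ((0 : Rd d), c • ξ))
      (by simp only [Function.uncurry_def]; exact Continuous.measurable (by fun_prop))
      (Eventually.of_forall fun ξ => (measurePreserving_sub_right volume _).map_eq)
  exact hmp.integrable_comp_of_integrable (hF.mul_prod h.integrable_stft)

namespace S0

/-- The product of `h ∈ S₀(ℝ^d)` with the dilate by `c` of the inverse Fourier transform of an
integrable function. -/
def mulFourierInv (F : Rd d → ℂ) (hF : Integrable F) (c : ℝ) (h : S0 d) : S0 d :=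
  ⟨fourierInvMul F c h, continuous_fourierInvMul hF c h.continuous,
    memLp_fourierInvMul hF c h.continuous h.memLp, by
      rw [funext (stft_fourierInvMul hF c h.memLp)]
      exact (integrable_mul_stft_sub hF c h).integral_prod_right⟩

@[simp] lemma mulFourierInv_apply (F : Rd d → ℂ) (hF : Integrable F) (c : ℝ) (h : S0 d)
    (x : Rd d) : mulFourierInv F hF c h x = 𝓕⁻ F (c • x) * h x := rfl

/-- Minkowski's inequality for ∫ F(ξ) (M_{cξ} h - a h) dξ, carried out by Fubini on the transform
side so that no S₀-valued integral is needed. The case a = 0 gives boundedness; a = 1 gives density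
when ∫ F = 1 and synthesis when ∫ F = 0. -/
lemma norm_mulFourierInv_sub_le (F : Rd d → ℂ) (hF : Integrable F) (c : ℝ) (h : S0 d) (a : ℂ) :
    ‖mulFourierInv F hF c h - (a * ∫ ξ, F ξ) • h‖
      ≤ ∫ ξ, ‖F ξ‖ * ‖modulate (c • ξ) h - a • h‖ := by
  let Φ : Rd d → Rd d × Rd d → ℂ := fun ξ p =>
    F ξ * (stft (gaussian d) h (p - (0, c • ξ)) - a * stft (gaussian d) h p)
  have hΦ : Integrable (Function.uncurry Φ) (volume.prod volume) := by
    refine ((integrable_mul_stft_sub hF c h).sub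
      ((hF.mul_prod h.integrable_stft).const_mul a)).congr (Eventually.of_forall fun q => ?_)
    simp only [Φ, Function.uncurry, Pi.sub_apply]
    ring
  have key : ∀ᵐ p, stft (gaussian d) (mulFourierInv F hF c h - (a * ∫ ξ, F ξ) • h : S0 d) p
      = ∫ ξ, Φ ξ p := by
    filter_upwards [(integrable_mul_stft_sub hF c h).prod_left_ae] with p hp
    rw [stft_sub_smul]
    have e := stft_fourierInvMul hF c h.memLp p
    change stft (gaussian d) (fourierInvMul F c h) p - _ = _
    simp only [Φ, mul_sub]
    rw [e, integral_sub hp (hF.mul_const _), integral_mul_const]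
    ring
  calc ‖mulFourierInv F hF c h - (a * ∫ ξ, F ξ) • h‖
      = ∫ p, ‖∫ ξ, Φ ξ p‖ := by
        rw [norm_def]
        exact integral_congr_ae (by filter_upwards [key] with p hp; rw [hp])
    _ ≤ ∫ p, ∫ ξ, ‖Φ ξ p‖ :=
        integral_mono hΦ.integral_prod_right.norm hΦ.norm.integral_prod_right
          fun p => norm_integral_le_integral_norm _
    _ = ∫ ξ, ∫ p, ‖Φ ξ p‖ := (integral_integral_swap hΦ.norm).symm
    _ = ∫ ξ, ‖F ξ‖ * ‖modulate (c • ξ) h - a • h‖ := by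
        simp only [Φ, norm_mul, integral_const_mul, norm_modulate_sub_smul]

lemma norm_mulFourierInv_le (F : Rd d → ℂ) (hF : Integrable F) (c : ℝ) (h : S0 d) :
    ‖mulFourierInv F hF c h‖ ≤ (∫ ξ, ‖F ξ‖) * ‖h‖ := by
  simpa [integral_mul_const] using norm_mulFourierInv_sub_le F hF c h 0

end S0

/-! ### The Gaussian and test functions in S₀ -/

lemma gaussian_ne_zero (x : Rd d) : gaussian d x ≠ 0 := by
  simp [gaussian]

lemma contDiff_gaussian (d : ℕ) : ContDiff ℝ (↑(⊤ : ℕ∞)) (gaussian d) := by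
  unfold gaussian
  exact Complex.ofRealCLM.contDiff.comp
    (Real.contDiff_exp.comp (contDiff_const.mul (contDiff_norm_sq ℝ)))

lemma stft_gaussian (p : Rd d × Rd d) :
    stft (gaussian d) (gaussian d) p
      = Complex.exp (((-(Real.pi * inner ℝ p.2 p.1) : ℝ) : ℂ) * Complex.I)
        * ((Real.pi / (2 * Real.pi : ℂ)) ^ ((Module.finrank ℝ (Rd d) : ℂ) / 2)
        * (Complex.exp (-(Real.pi / 2 : ℂ) * ‖p.1‖ ^ 2)
          * Complex.exp (-(Real.pi / 2 : ℂ) * ‖p.2‖ ^ 2))) := by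
  have hG := GaussianFourier.integral_cexp_neg_mul_sq_norm_add (V := Rd d)
    (b := (2 * Real.pi : ℂ)) (by simp [Real.pi_pos]) (-(2 * Real.pi * Complex.I)) p.2
  have e : (-(2 * Real.pi * Complex.I)) ^ 2 * (‖p.2‖ : ℂ) ^ 2 / (4 * (2 * Real.pi))
      = -(Real.pi / 2 : ℂ) * ‖p.2‖ ^ 2 := by
    have : (Real.pi : ℂ) ≠ 0 := by exact_mod_cast Real.pi_ne_zero
    field_simp
    rw [Complex.I_sq]
    ring
  rw [e] at hG
  -- Moving the origin to the midpoint p.1 / 2 turns the product of the two Gaussians into one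
  -- centred Gaussian (parallelogram law) and leaves the phase exp(-πi⟨s, t⟩).
  rw [mul_left_comm _ (Complex.exp _) (Complex.exp _), ← hG, ← integral_const_mul,
    ← integral_const_mul, stft, ← integral_add_right_eq_self _ ((1 / 2 : ℝ) • p.1)]
  congr 1
  funext y
  have hsum : ‖y + (1 / 2 : ℝ) • p.1‖ ^ 2 + ‖y + (1 / 2 : ℝ) • p.1 - p.1‖ ^ 2
      = 2 * ‖y‖ ^ 2 + (1 / 2) * ‖p.1‖ ^ 2 := by
    have : y + (1 / 2 : ℝ) • p.1 - p.1 = y - (1 / 2 : ℝ) • p.1 := by module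
    rw [this, norm_add_sq_real, norm_sub_sq_real, norm_smul, mul_pow]
    norm_num
    ring
  rw [conj_modulation]
  simp only [gaussian, translation, Complex.conj_ofReal]
  simp only [Complex.ofReal_exp, ← Complex.exp_add]
  congr 1
  have hc := congrArg (fun r : ℝ => (r : ℂ)) hsum
  push_cast at hc
  rw [inner_add_right, real_inner_smul_right]
  push_cast
  linear_combination (-(Real.pi : ℂ)) * hc

lemma integrable_cexp_neg_half_pi (d : ℕ) :
    Integrable fun v : Rd d => Complex.exp (-(Real.pi / 2 : ℂ) * ‖v‖ ^ 2) := by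
  simpa using GaussianFourier.integrable_cexp_neg_mul_sq_norm_add (V := Rd d)
    (b := (Real.pi / 2 : ℂ)) (by simp [Real.pi_pos]) 0 0

lemma gaussian_mem (d : ℕ) : gaussian d ∈ s0Submodule d := by
  refine ⟨continuous_gaussian d, ?_, ?_⟩
  · have h := memLp_shift (0 : Rd d × Rd d)
    have e : modulation (0 : Rd d × Rd d).2 (translation (0 : Rd d × Rd d).1 (gaussian d))
        = gaussian d := by
      funext x; simp [modulation, translation]
    rwa [e] at h
  · rw [funext stft_gaussian]
    refine Integrable.bdd_mul (c := 1) ?_ (Continuous.aestronglyMeasurable (by fun_prop))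
      (Eventually.of_forall fun p => (Complex.norm_exp_ofReal_mul_I _).le)
    exact ((integrable_cexp_neg_half_pi d).mul_prod (integrable_cexp_neg_half_pi d)).const_mul _

lemma integrable_fourier_of_contDiff {φ : Rd d → ℂ} (hφ : ContDiff ℝ (↑(⊤ : ℕ∞)) φ)
    (hc : HasCompactSupport φ) : Integrable (𝓕 φ) := by
  have h := (𝓕 (hc.toSchwartzMap hφ)).integrable (μ := volume)
  rw [SchwartzMap.fourier_coe] at h
  exact h

lemma fourierInv_fourier_of_contDiff {φ : Rd d → ℂ} (hφ : ContDiff ℝ (↑(⊤ : ℕ∞)) φ)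
    (hc : HasCompactSupport φ) : 𝓕⁻ (𝓕 φ) = φ :=
  hφ.continuous.fourierInv_fourier_eq (hφ.continuous.integrable_of_hasCompactSupport hc)
    (integrable_fourier_of_contDiff hφ hc)

lemma integral_eq_fourierInv_zero (F : Rd d → ℂ) : ∫ ξ, F ξ = 𝓕⁻ F 0 := by
  simp [Real.fourierInv_eq']

namespace S0

/-- `S₀(ℝ^d)` is closed under multiplication by test functions. -/
lemma exists_contDiff_mul {φ : Rd d → ℂ} (hφ : ContDiff ℝ (↑(⊤ : ℕ∞)) φ)
    (hc : HasCompactSupport φ) (f : S0 d) : ∃ k : S0 d, ∀ x, k x = φ x * f x :=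
  ⟨mulFourierInv (𝓕 φ) (integrable_fourier_of_contDiff hφ hc) 1 f, fun x => by
    rw [mulFourierInv_apply, fourierInv_fourier_of_contDiff hφ hc, one_smul]⟩

/-- Since g₀ has no zeros, φ is the test function φ / g₀ times g₀ ∈ S₀. -/
lemma exists_of_contDiff {φ : Rd d → ℂ} (hφ : ContDiff ℝ (↑(⊤ : ℕ∞)) φ)
    (hc : HasCompactSupport φ) : ∃ k : S0 d, ∀ x, k x = φ x := by
  obtain ⟨k, hk⟩ := exists_contDiff_mul (φ := fun x => φ x * (gaussian d x)⁻¹)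
    (hφ.mul ((contDiff_gaussian d).inv gaussian_ne_zero)) hc.mul_right
    ⟨gaussian d, gaussian_mem d⟩
  refine ⟨k, fun x => (hk x).trans ?_⟩
  exact inv_mul_cancel_right₀ (gaussian_ne_zero x) _

end S0

/-! ### Continuity of translation in L¹ and dilation limits -/

lemma continuous_integral_norm_sub_translate {W : Type*} [NormedAddCommGroup W]
    [NormedSpace ℝ W] [FiniteDimensional ℝ W] [MeasurableSpace W] [BorelSpace W]
    (μ : Measure W) [μ.IsAddHaarMeasure] {G : W → ℂ} (hG : Integrable G μ) :
    Continuous fun w => ∫ x, ‖G (x - w) - G x‖ ∂μ := by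
  have : ProperSpace W := FiniteDimensional.proper ℝ W
  have : Fact ((1 : ENNReal) ≠ ⊤) := ⟨ENNReal.one_ne_top⟩
  -- The action of `DomAddAct.mk a` is precomposition with x ↦ a + x, hence the sign.
  have hm : Continuous fun w : W => DomAddAct.mk (-w) :=
    DomAddAct.continuous_mk.comp continuous_neg
  have h1 : Continuous fun w : W =>
      ‖(DomAddAct.mk (-w) +ᵥ hG.toL1 G : Lp ℂ 1 μ) - hG.toL1 G‖ :=
    ((hm.vadd continuous_const).sub continuous_const).norm
  convert h1 using 2 with w
  have hw : Integrable (fun x => G (x - w)) μ := hG.comp_sub_right w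
  have e : (DomAddAct.mk (-w) +ᵥ hG.toL1 G : Lp ℂ 1 μ) = hw.toL1 _ := by
    refine Lp.ext ((DomAddAct.vadd_Lp_ae_eq _ _).trans ?_)
    have hmp := measurePreserving_add_left μ (-w)
    filter_upwards [hmp.quasiMeasurePreserving.ae hG.coeFn_toL1, hw.coeFn_toL1] with x hx hx'
    rw [hx']
    refine hx.trans ?_
    rw [neg_add_eq_sub]
  rw [e, ← Integrable.toL1_sub, L1.norm_of_fun_eq_integral_norm]
  rfl

lemma tendsto_integral_mul_dilate {F : Rd d → ℂ} (hF : Integrable F) {N : Rd d → ℝ}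
    (hN : Continuous N) (h0 : N 0 = 0) {C : ℝ} (hC : ∀ ξ, |N ξ| ≤ C) :
    Tendsto (fun c : ℝ => ∫ ξ, ‖F ξ‖ * N (c • ξ)) (𝓝 0) (𝓝 0) := by
  have : Continuous fun c : ℝ => ∫ ξ, ‖F ξ‖ * N (c • ξ) := by
    refine continuous_of_dominated (bound := fun ξ => ‖F ξ‖ * C) (fun c => ?_) (fun c => ?_)
      (hF.norm.mul_const C) ?_
    · exact hF.aestronglyMeasurable.norm.mul
        (hN.comp (continuous_const_smul c)).aestronglyMeasurable
    · refine Eventually.of_forall fun ξ => ?_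
      rw [norm_mul, norm_norm]
      exact mul_le_mul_of_nonneg_left (hC _) (norm_nonneg _)
    · exact Eventually.of_forall fun ξ =>
        continuous_const.mul (hN.comp (continuous_id.smul continuous_const))
  simpa [h0] using this.tendsto 0

lemma fourierInv_sub_apply {F G : Rd d → ℂ} (hF : Integrable F) (hG : Integrable G) (y : Rd d) :
    𝓕⁻ (F - G) y = 𝓕⁻ F y - 𝓕⁻ G y := by
  have h : ∀ {H : Rd d → ℂ}, Integrable H →
      Integrable fun ξ => Complex.exp (((2 * Real.pi * inner ℝ ξ y : ℝ) : ℂ) * Complex.I) • H ξ :=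
    fun hH => hH.bdd_mul (c := 1) (Continuous.aestronglyMeasurable (by fun_prop))
      (Eventually.of_forall fun _ => (Complex.norm_exp_ofReal_mul_I _).le)
  simp only [Real.fourierInv_eq', Pi.sub_apply, smul_sub]
  exact integral_sub (h hF) (h hG)

lemma fourierInv_translate (G : Rd d → ℂ) (η y : Rd d) :
    𝓕⁻ (fun ξ => G (ξ - η)) y
      = Complex.exp (2 * Real.pi * Complex.I * ((inner ℝ η y : ℝ) : ℂ)) * 𝓕⁻ G y := by
  rw [Real.fourierInv_eq', Real.fourierInv_eq', ← integral_const_mul,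
    ← integral_add_right_eq_self _ η]
  congr 1
  funext ξ
  rw [add_sub_cancel_right, smul_eq_mul, smul_eq_mul, ← mul_assoc, ← Complex.exp_add,
    inner_add_left]
  congr 2
  push_cast
  ring

/-! ### Density of compact support and spectral synthesis at a point -/

namespace S0

lemma continuous_norm_modulate_sub (f : S0 d) : Continuous fun ξ => ‖modulate ξ f - f‖ := by
  have h := (continuous_integral_norm_sub_translate volume f.integrable_stft).comp
    (Continuous.prodMk (continuous_const (y := (0 : Rd d))) continuous_id)
  refine h.congr fun ξ => ?_
  simpa using (norm_modulate_sub_smul ξ f 1).symm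

lemma modulate_zero (f : S0 d) : modulate 0 f = f := by
  ext x; simp [modulation]

/-- Compactly supported functions are dense in `S₀(ℝ^d)`. -/
lemma exists_hasCompactSupport_norm_sub_lt (f : S0 d) {ε : ℝ} (hε : 0 < ε) :
    ∃ k : S0 d, HasCompactSupport k ∧ ‖k - f‖ < ε := by
  let b : ContDiffBump (0 : Rd d) := ⟨1, 2, one_pos, one_lt_two⟩
  let φ : Rd d → ℂ := fun x => (b x : ℂ)
  have hφ : ContDiff ℝ (↑(⊤ : ℕ∞)) φ := Complex.ofRealCLM.contDiff.comp b.contDiff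
  have hc : HasCompactSupport φ := b.hasCompactSupport.comp_left Complex.ofReal_zero
  have hF := integrable_fourier_of_contDiff hφ hc
  have hinv := fourierInv_fourier_of_contDiff hφ hc
  have hlim := tendsto_integral_mul_dilate hF (continuous_norm_modulate_sub f)
    (by simp [modulate_zero]) (C := ‖f‖ + ‖f‖)
    (fun ξ => by simpa using norm_sub_le (modulate ξ f) f)
  -- The neighbourhood is punctured because φ(c x) has compact support only for c ≠ 0.
  obtain ⟨c, hcε, hc0⟩ := ((hlim.eventually (gt_mem_nhds hε)).filter_mono
    nhdsWithin_le_nhds |>.and (self_mem_nhdsWithin (a := (0 : ℝ)) (s := {0}ᶜ))).exists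
  refine ⟨mulFourierInv (𝓕 φ) hF c f, ?_, ?_⟩
  · have : HasCompactSupport fun x : Rd d => φ (c • x) :=
      hc.comp_homeomorph (Homeomorph.smulOfNeZero c hc0)
    have h2 : ((mulFourierInv (𝓕 φ) hF c f : S0 d) : Rd d → ℂ) = fun x => φ (c • x) * f x := by
      funext x
      rw [mulFourierInv_apply, hinv]
    rw [h2]
    exact this.mul_right
  · have h := norm_mulFourierInv_sub_le (𝓕 φ) hF c f 1
    have h1 : ∫ ξ, 𝓕 φ ξ = 1 := by
      rw [integral_eq_fourierInv_zero, hinv]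
      simp [φ, b.one_of_mem_closedBall (Metric.mem_closedBall_self b.rIn_pos.le)]
    rw [h1] at h
    simp only [mul_one, one_smul] at h
    exact h.trans_lt hcε

/-- Fourier inversion for the windowed functions `x ↦ f x * g₀ (x - t)`. -/
lemma ae_fourierInv_stft (f : S0 d) :
    ∀ᵐ t : Rd d, Integrable (fun s => stft (gaussian d) f (t, s)) ∧
      ∀ x, 𝓕⁻ (fun s => stft (gaussian d) f (t, s)) x = f x * gaussian d (x - t) := by
  have hi := f.integrable_stft
  rw [Measure.volume_eq_prod] at hi
  filter_upwards [hi.prod_right_ae] with t ht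
  refine ⟨ht, fun x => ?_⟩
  let k : Rd d → ℂ := fun x => f x * gaussian d (x - t)
  have hk : Continuous k := by
    have := continuous_gaussian d
    have := f.continuous
    fun_prop
  have hki : Integrable k := by
    have := integrable_stft_integrand f.memLp (t, 0)
    simp only [conj_modulation, translation, gaussian, Complex.conj_ofReal] at this
    simpa [gaussian, k] using this
  have hF : 𝓕 k = fun s => stft (gaussian d) f (t, s) := by
    funext s
    rw [Real.fourier_eq', stft]
    congr 1
    funext x
    rw [conj_modulation]
    have e : ((-2 * Real.pi * inner ℝ x s : ℝ) : ℂ) * Complex.I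
        = -(2 * Real.pi * Complex.I * ((inner ℝ s x : ℝ) : ℂ)) := by
      rw [real_inner_comm]; push_cast; ring
    rw [e]
    simp only [k, smul_eq_mul, translation, gaussian, Complex.conj_ofReal]
    ring
  have hinv := hk.fourierInv_fourier_eq hki (by rwa [hF])
  rw [hF] at hinv
  exact congrFun hinv x

/-- A function in `S₀(ℝ^d)` that vanishes at the origin agrees near the origin with functions
of arbitrarily small norm. -/
lemma exists_small_eventuallyEq_zero (f : S0 d) (h0 : f 0 = 0) {r ε : ℝ} (hr : 0 < r)
    (hε : 0 < ε) :
    ∃ k : S0 d, ‖k‖ < ε ∧ (∀ x, r ≤ ‖x‖ → k x = 0) ∧ ∀ᶠ x in 𝓝 (0 : Rd d), k x = f x := by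
  let b : ContDiffBump (0 : Rd d) := ⟨r / 2, r, half_pos hr, half_lt_self hr⟩
  let φ : Rd d → ℂ := fun x => (b x : ℂ)
  have hφ : ContDiff ℝ (↑(⊤ : ℕ∞)) φ := Complex.ofRealCLM.contDiff.comp b.contDiff
  have hc : HasCompactSupport φ := b.hasCompactSupport.comp_left Complex.ofReal_zero
  have hG := integrable_fourier_of_contDiff hφ hc
  have hinv := fourierInv_fourier_of_contDiff hφ hc
  obtain ⟨t, hF, hFinv⟩ := f.ae_fourierInv_stft.exists
  set F : Rd d → ℂ := fun s => stft (gaussian d) f (t, s)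
  have hF0 : ∫ ξ, F ξ = 0 := by rw [integral_eq_fourierInv_zero, hFinv, h0, zero_mul]
  -- Dividing by the window cancels the factor g₀(x - t) that comes with 𝓕⁻ F.
  obtain ⟨h, hh⟩ := exists_of_contDiff (φ := fun x => φ x * (gaussian d (x - t))⁻¹)
    (hφ.mul (((contDiff_gaussian d).comp (contDiff_id.sub contDiff_const)).inv
      fun x => gaussian_ne_zero _)) hc.mul_right
  let N : Rd d → ℝ := fun η => ∫ y, ‖𝓕 φ (y - η) - 𝓕 φ y‖
  have hNc : Continuous N := continuous_integral_norm_sub_translate volume hG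
  have hNb : ∀ η, |N η| ≤ (∫ y, ‖𝓕 φ y‖) + ∫ y, ‖𝓕 φ y‖ := fun η => by
    rw [abs_of_nonneg (integral_nonneg fun _ => norm_nonneg _)]
    have hGη := hG.comp_sub_right η
    refine (integral_mono (hGη.sub hG).norm (hGη.norm.add hG.norm)
      fun y => norm_sub_le _ _).trans (le_of_eq ?_)
    rw [integral_add' hGη.norm hG.norm, integral_sub_right_eq_self (fun y => ‖𝓕 φ y‖) η]
  have hlim := (tendsto_integral_mul_dilate hF hNc (by simp [N]) hNb).mul_const ‖h‖
  rw [zero_mul] at hlim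
  obtain ⟨c, hcε, hc0⟩ := ((hlim.eventually (gt_mem_nhds hε)).filter_mono
    nhdsWithin_le_nhds |>.and (self_mem_nhdsWithin (a := (0 : ℝ)) (s := {0}ᶜ))).exists
  have hc0 : c ≠ 0 := hc0
  -- This is the shrinking bump φ(x / c) h(x).
  let hc' : S0 d := mulFourierInv (𝓕 φ) hG c⁻¹ h
  have hbound : ∀ ξ, ‖modulate ξ hc' - hc'‖ ≤ N (c • ξ) * ‖h‖ := fun ξ => by
    -- Modulating φ(x / c) by ξ translates φ̂ by cξ, so the difference is again a product with an
    -- inverse transform, now of a function with small L¹ norm.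
    have e : modulate ξ hc' - hc'
        = mulFourierInv _ ((hG.comp_sub_right (c • ξ)).sub hG) c⁻¹ h := by
      ext x
      have hsub : 𝓕⁻ ((fun y => 𝓕 φ (y - c • ξ)) - 𝓕 φ) (c⁻¹ • x)
          = 𝓕⁻ (fun y => 𝓕 φ (y - c • ξ)) (c⁻¹ • x) - 𝓕⁻ (𝓕 φ) (c⁻¹ • x) :=
        fourierInv_sub_apply (hG.comp_sub_right _) hG _
      rw [mulFourierInv_apply, hsub, fourierInv_translate, real_inner_smul_left,
        real_inner_smul_right, mul_inv_cancel_left₀ hc0]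
      simp only [sub_apply, modulate_apply, modulation, hc', mulFourierInv_apply]
      ring
    rw [e]
    exact norm_mulFourierInv_le _ _ _ _
  have hk : ∀ x, mulFourierInv F hF 1 hc' x = f x * φ (c⁻¹ • x) * φ x := fun x => by
    rw [mulFourierInv_apply, one_smul, hFinv, mulFourierInv_apply, hinv, hh]
    have := gaussian_ne_zero (x - t)
    field_simp
  refine ⟨mulFourierInv F hF 1 hc', ?_, fun x hx => ?_, ?_⟩
  -- As ∫ F = 0, subtracting (∫ F) • hc' costs nothing.
  · have h1 := norm_mulFourierInv_sub_le F hF 1 hc' 1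
    simp only [hF0, mul_zero, zero_smul, sub_zero, one_smul] at h1
    refine (h1.trans ?_).trans_lt hcε
    rw [← integral_mul_const]
    refine integral_mono_of_nonneg
      (Eventually.of_forall fun ξ => mul_nonneg (norm_nonneg _) (norm_nonneg _)) ?_
      (Eventually.of_forall fun ξ => ?_)
    · refine Integrable.mul_const (hF.norm.mul_bdd (c := _)
        (hNc.comp (continuous_const_smul c)).aestronglyMeasurable
        (Eventually.of_forall fun ξ => hNb _)) _
    · simp only [mul_assoc]
      exact mul_le_mul_of_nonneg_left (hbound ξ) (norm_nonneg _)
  · rw [hk]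
    simp [φ, b.zero_of_le_dist (x := x) (by simpa using hx)]
  · have h1 : ∀ᶠ x in 𝓝 (0 : Rd d), b x = 1 :=
      b.eventuallyEq_one
    have h2 : ∀ᶠ x in 𝓝 (0 : Rd d), b (c⁻¹ • x) = 1 := by
      have : Tendsto (fun x : Rd d => c⁻¹ • x) (𝓝 0) (𝓝 0) := by
        simpa using (continuous_const_smul c⁻¹).tendsto (0 : Rd d)
      exact this.eventually h1
    filter_upwards [h1, h2] with x hx1 hx2
    rw [hk]
    simp [φ, hx1, hx2]

/-- Spectral synthesis for a point. -/
lemma exists_small_eventuallyEq (f : S0 d) {z : Rd d} (h0 : f z = 0) {r ε : ℝ} (hr : 0 < r)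
    (hε : 0 < ε) :
    ∃ k : S0 d, ‖k‖ < ε ∧ (∀ x, r ≤ dist x z → k x = 0) ∧ ∀ᶠ x in 𝓝 z, k x = f x := by
  obtain ⟨k, hk, hk0, hkf⟩ := exists_small_eventuallyEq_zero (translate (-z) f)
    (by simpa using h0) hr hε
  refine ⟨translate z k, by simpa using hk, fun x hx => ?_, ?_⟩
  · exact hk0 _ (by rwa [← dist_eq_norm])
  · have : Tendsto (fun x => x - z) (𝓝 z) (𝓝 0) := by
      simpa using (continuous_sub_right z).tendsto z
    filter_upwards [this.eventually hkf] with x hx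
    simpa using hx

end S0

/-! ### Sampling on uniformly discrete sets -/

namespace S0

lemma integrable_integral_norm_stft (f : S0 d) :
    Integrable fun t : Rd d => ∫ s : Rd d, ‖stft (gaussian d) f (t, s)‖ := by
  have hi := f.integrable_stft.norm
  rw [Measure.volume_eq_prod] at hi
  exact hi.integral_prod_left

lemma norm_eq_integral_integral (f : S0 d) :
    ‖f‖ = ∫ t : Rd d, ∫ s : Rd d, ‖stft (gaussian d) f (t, s)‖ := by
  have hi := f.integrable_stft.norm
  rw [Measure.volume_eq_prod] at hi
  rw [norm_def, Measure.volume_eq_prod, integral_prod _ hi]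

/-- Point values are controlled by the short-time Fourier transform near the point. -/
lemma norm_apply_mul_le (f : S0 d) (x : Rd d) (r : ℝ) :
    ‖f x‖ * (Real.exp (-Real.pi * r ^ 2) * volume.real (Metric.ball (0 : Rd d) r))
      ≤ ∫ t in Metric.ball x r, ∫ s : Rd d, ‖stft (gaussian d) f (t, s)‖ := by
  have hball : volume.real (Metric.ball (0 : Rd d) r) = volume.real (Metric.ball x r) := by
    simp only [measureReal_def, Measure.addHaar_ball_center]
  have hconst : ‖f x‖ * (Real.exp (-Real.pi * r ^ 2) * volume.real (Metric.ball (0 : Rd d) r))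
      = ∫ _ in Metric.ball x r, ‖f x‖ * Real.exp (-Real.pi * r ^ 2) := by
    rw [hball, setIntegral_const, smul_eq_mul]
    ring
  rw [hconst]
  refine setIntegral_mono_on_ae
    (integrableOn_const (Metric.isBounded_ball.measure_lt_top.ne))
    f.integrable_integral_norm_stft.integrableOn measurableSet_ball ?_
  filter_upwards [f.ae_fourierInv_stft] with t ht htx
  -- The windowed function is bounded by the L¹ norm of its transform; on the ball the window is at
  -- least exp(-πr²).
  have h1 : ‖f x‖ * ‖gaussian d (x - t)‖ ≤ ∫ s : Rd d, ‖stft (gaussian d) f (t, s)‖ := by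
    rw [← norm_mul, ← ht.2 x]
    exact norm_fourierInv_le _ _
  refine le_trans (mul_le_mul_of_nonneg_left ?_ (norm_nonneg _)) h1
  rw [gaussian, Complex.norm_real, Real.norm_eq_abs, Real.abs_exp, Real.exp_le_exp]
  have h2 : ‖x - t‖ ≤ r := by
    rw [← dist_eq_norm, dist_comm]; exact (Metric.mem_ball.1 htx).le
  have h3 : ‖x - t‖ ^ 2 ≤ r ^ 2 := pow_le_pow_left₀ (norm_nonneg _) h2 2
  nlinarith [Real.pi_pos]

/-- Sampling on a uniformly discrete set maps `S₀(ℝ^d)` boundedly into `ℓ¹`. -/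
lemma exists_sum_norm_apply_le {ι : Type*} (x : ι → Rd d) {r : ℝ} (hr : 0 < r)
    (hx : Pairwise fun i j => Disjoint (Metric.ball (x i) r) (Metric.ball (x j) r)) :
    ∃ C : ℝ, 0 ≤ C ∧ ∀ (f : S0 d) (s : Finset ι), ∑ i ∈ s, ‖f (x i)‖ ≤ C * ‖f‖ := by
  set K := Real.exp (-Real.pi * r ^ 2) * volume.real (Metric.ball (0 : Rd d) r)
  have hK : 0 < K := mul_pos (Real.exp_pos _)
    (ENNReal.toReal_pos (Metric.measure_ball_pos _ _ hr).ne'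
      Metric.isBounded_ball.measure_lt_top.ne)
  refine ⟨K⁻¹, (inv_pos.2 hK).le, fun f s => ?_⟩
  rw [inv_mul_eq_div, le_div_iff₀ hK, Finset.sum_mul]
  calc ∑ i ∈ s, ‖f (x i)‖ * K
      ≤ ∑ i ∈ s, ∫ t in Metric.ball (x i) r, ∫ s : Rd d, ‖stft (gaussian d) f (t, s)‖ :=
        Finset.sum_le_sum fun i _ => norm_apply_mul_le f (x i) r
    _ = ∫ t in ⋃ i ∈ s, Metric.ball (x i) r, ∫ s : Rd d, ‖stft (gaussian d) f (t, s)‖ :=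
        (integral_biUnion_finset s (fun _ _ => measurableSet_ball) (fun i _ j _ hij => hx hij)
          fun _ _ => f.integrable_integral_norm_stft.integrableOn).symm
    _ ≤ ‖f‖ := by
        rw [norm_eq_integral_integral]
        exact setIntegral_le_integral f.integrable_integral_norm_stft
          (Eventually.of_forall fun t => integral_nonneg fun _ => norm_nonneg _)

end S0

/-! ### Localisation by partitions of unity -/

/-- A mild distribution vanishes on compactly supported functions whose support avoids its
support. -/
lemma apply_eq_zero_of_disjoint_supp (σ : MildDistribution d) (f : S0 d)
    (hf : HasCompactSupport f) (hd : Disjoint (tsupport f) (supp σ)) : σ f = 0 := by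
  have htriv : ∀ z ∈ tsupport f, IsTrivialActionPoint σ z := fun z hz => by
    have := Set.disjoint_left.1 hd hz
    rwa [supp, Set.notMem_compl_iff] at this
  choose! δ hδ hσ using htriv
  obtain ⟨t, htK, hcov⟩ := IsCompact.elim_nhds_subcover hf (fun z => Metric.ball z (δ z))
    fun z hz => Metric.ball_mem_nhds z (hδ z hz)
  obtain ⟨ρ, hρ⟩ := SmoothPartitionOfUnity.exists_isSubordinate (modelWithCornersSelf ℝ (Rd d))
    (isClosed_tsupport f) (fun z : t => Metric.ball (z : Rd d) (δ z)) (fun _ => Metric.isOpen_ball)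
    (by simpa [Set.iUnion_subtype] using hcov)
  have hk : ∀ i : t, ∃ k : S0 d, ∀ x, k x = (ρ i x : ℂ) * f x := fun i => by
    refine S0.exists_contDiff_mul (φ := fun x => (ρ i x : ℂ))
      (Complex.ofRealCLM.contDiff.comp (ρ i).contMDiff.contDiff) ?_ f
    have : HasCompactSupport (ρ i) :=
      Metric.isCompact_of_isClosed_isBounded (isClosed_tsupport _)
        (Metric.isBounded_ball.subset (hρ i))
    exact this.comp_left Complex.ofReal_zero
  choose k hk using hk
  have hsum : f = ∑ i, k i := by
    ext x
    rw [S0.sum_apply]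
    simp only [hk, ← Finset.sum_mul]
    by_cases hx : x ∈ tsupport f
    · have h1 := ρ.sum_eq_one hx
      rw [finsum_eq_sum_of_fintype] at h1
      rw [← Complex.ofReal_sum, h1, Complex.ofReal_one, one_mul]
    · rw [image_eq_zero_of_notMem_tsupport hx, mul_zero]
  rw [hsum, map_sum]
  refine Finset.sum_eq_zero fun i _ => hσ i (htK i i.2) (k i) ?_
  refine Set.Subset.trans ?_ (hρ i)
  refine closure_mono fun x hx h0 => hx ?_
  rw [hk, h0, Complex.ofReal_zero, zero_mul]

/-! ### Distributions supported on a lattice -/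

section Lattice

variable (Λ : Submodule ℤ (Rd d)) [DiscreteTopology Λ]

lemma isClosed_lattice : IsClosed (Λ : Set (Rd d)) := by
  have : DiscreteTopology Λ.toAddSubgroup := ‹DiscreteTopology Λ›
  exact AddSubgroup.isClosed_of_discrete (H := Λ.toAddSubgroup)

lemma finite_inter_lattice {K : Set (Rd d)} (hK : IsCompact K) : (K ∩ (Λ : Set (Rd d))).Finite :=
  Metric.finite_isBounded_inter_isClosed ⟨‹DiscreteTopology Λ›⟩ hK.isBounded (isClosed_lattice Λ)

lemma exists_separation : ∃ r > 0, ∀ x ∈ Λ, ∀ y ∈ Λ, dist x y < r → x = y := by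
  obtain ⟨r, hr, h⟩ := Metric.isOpen_singleton_iff.1 (isOpen_discrete ({0} : Set Λ))
  refine ⟨r, hr, fun x hx y hy hxy => sub_eq_zero.1 ?_⟩
  have := h ⟨x - y, Λ.sub_mem hx hy⟩ (by simpa [Subtype.dist_eq, dist_eq_norm] using hxy)
  exact congrArg Subtype.val this

variable {Λ}

/-- A mild distribution supported on a lattice vanishes on compactly supported functions that
vanish on the lattice. -/
lemma apply_eq_zero_of_vanish_on_lattice {σ : MildDistribution d} (hσ : supp σ ⊆ Λ) (f : S0 d)
    (hf : HasCompactSupport f) (h0 : ∀ x ∈ Λ, f x = 0) : σ f = 0 := by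
  obtain ⟨r, hr, hsep⟩ := exists_separation Λ
  set s := (finite_inter_lattice Λ hf).toFinset
  have hs : ∀ z, z ∈ s ↔ z ∈ tsupport f ∧ z ∈ Λ := fun z => by simp [s]
  refine norm_le_zero_iff.1 (le_of_forall_pos_le_add fun ε hε => ?_)
  rw [zero_add]
  obtain ⟨η, hη, hηε⟩ : ∃ η > 0, ‖σ‖ * (s.card * η) ≤ ε := by
    -- The summand 1 keeps the denominator positive when σ = 0 or s is empty.
    refine ⟨ε / (‖σ‖ * s.card + 1), by positivity, ?_⟩
    rw [← mul_assoc, mul_div_assoc', div_le_iff₀ (by positivity)]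
    nlinarith
  have hk : ∀ z : Rd d, z ∈ s → ∃ k : S0 d, ‖k‖ < η ∧
      (∀ x, r / 2 ≤ dist x z → k x = 0) ∧ ∀ᶠ x in 𝓝 z, k x = f x := fun z hz =>
    S0.exists_small_eventuallyEq f (h0 z ((hs z).1 hz).2) (half_pos hr) hη
  choose! k hkη hk0 hkf using hk
  have hvanish : ∀ z ∈ Λ, ∀ w ∈ s, w ≠ z → ∀ᶠ x in 𝓝 z, k w x = 0 := fun z hz w hw hwz => by
    filter_upwards [Metric.ball_mem_nhds z (half_pos hr)] with x hx
    refine hk0 w hw x ?_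
    by_contra! hlt
    refine hwz (hsep w ((hs w).1 hw).2 z hz ?_)
    linarith [dist_triangle_left w z x, Metric.mem_ball.1 hx]
  -- The difference vanishes near every z ∈ Λ: the k w with w ≠ z vanish there, and either k z
  -- cancels f, or z ∉ s and f itself vanishes near z.
  have hσ0 : σ (f - ∑ w ∈ s, k w) = 0 := by
    refine apply_eq_zero_of_disjoint_supp σ _ ?_ ?_
    · have hK : IsCompact (tsupport f ∪ ⋃ w ∈ s, Metric.closedBall w (r / 2)) :=
        hf.isCompact.union (s.isCompact_biUnion fun w _ => isCompact_closedBall w _)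
      refine HasCompactSupport.intro hK fun x hx => ?_
      simp only [Set.mem_union, Set.mem_iUnion, not_or, not_exists, Metric.mem_closedBall,
        not_le] at hx
      rw [S0.sub_apply, S0.sum_apply, image_eq_zero_of_notMem_tsupport hx.1,
        Finset.sum_eq_zero fun w hw => hk0 w hw x (hx.2 w hw).le, sub_zero]
    · refine Set.disjoint_right.2 fun z hz => ?_
      have hz : z ∈ Λ := hσ hz
      rw [notMem_tsupport_iff_eventuallyEq]
      have hall : ∀ᶠ x in 𝓝 z, ∀ w ∈ s, w ≠ z → k w x = 0 := by
        rw [Filter.eventually_all_finset]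
        intro w hw
        by_cases hwz : w = z
        · exact Eventually.of_forall fun x h => absurd hwz h
        · filter_upwards [hvanish z hz w hw hwz] with x hx _ using hx
      by_cases hzs : z ∈ s
      · filter_upwards [hall, hkf z hzs] with x hx hxz
        rw [S0.sub_apply, S0.sum_apply, Finset.sum_eq_single_of_mem z hzs (fun w hw => hx w hw),
          hxz, sub_self, Pi.zero_apply]
      · have hzf : z ∉ tsupport f := fun h => hzs ((hs z).2 ⟨h, hz⟩)
        filter_upwards [hall, notMem_tsupport_iff_eventuallyEq.1 hzf] with x hx hxf
        rw [S0.sub_apply, S0.sum_apply, hxf, Finset.sum_eq_zero fun w hw => hx w hw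
          (fun h => hzs (h ▸ hw)), Pi.zero_apply, sub_zero]
  rw [map_sub, sub_eq_zero] at hσ0
  rw [hσ0]
  refine (σ.le_opNorm _).trans (le_trans (mul_le_mul_of_nonneg_left ?_ (norm_nonneg _)) hηε)
  refine (norm_sum_le _ _).trans ((Finset.sum_le_card_nsmul _ _ η fun w hw => (hkη w hw).le).trans
    (by rw [nsmul_eq_mul]))

lemma exists_weightedDiracComb {σ : MildDistribution d} (hσ : supp σ ⊆ Λ) :
    ∃ c : Λ → ℂ, (∃ C : ℝ, ∀ l : Λ, ‖c l‖ ≤ C) ∧ IsWeightedDiracComb Λ c σ := by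
  classical
  obtain ⟨r, hr, hsep⟩ := exists_separation Λ
  -- The outer radius is the separation of Λ, so on Λ the lattice translates of the bump are
  -- Kronecker deltas.
  let b : ContDiffBump (0 : Rd d) := ⟨r / 2, r, half_pos hr, half_lt_self hr⟩
  have hbc : HasCompactSupport fun x => (b x : ℂ) :=
    b.hasCompactSupport.comp_left Complex.ofReal_zero
  obtain ⟨φ, hφ⟩ := S0.exists_of_contDiff (φ := fun x => (b x : ℂ))
    (Complex.ofRealCLM.contDiff.comp b.contDiff) hbc
  have hφc : HasCompactSupport φ := by rwa [show (φ : Rd d → ℂ) = _ from funext hφ]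
  have hφΛ : ∀ x ∈ Λ, ∀ y ∈ Λ, φ (x - y) = if x = y then 1 else 0 := fun x hx y hy => by
    rw [hφ]
    split_ifs with h
    · rw [h, sub_self, b.one_of_mem_closedBall (Metric.mem_closedBall_self b.rIn_pos.le),
        Complex.ofReal_one]
    · rw [b.zero_of_le_dist, Complex.ofReal_zero]
      rw [dist_zero_right, ← dist_eq_norm]
      exact not_lt.1 fun hlt => h (hsep x hx y hy hlt)
  let c : Λ → ℂ := fun l => σ (S0.translate l φ)
  have hcb : ∀ l : Λ, ‖c l‖ ≤ ‖σ‖ * ‖φ‖ := fun l => by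
    simpa using σ.le_opNorm (S0.translate l φ)
  obtain ⟨C, hC0, hC⟩ := S0.exists_sum_norm_apply_le (fun l : Λ => (l : Rd d)) (half_pos hr)
    (fun l m hlm => Metric.ball_disjoint_ball (by
      rw [add_halves]
      exact not_lt.1 fun hlt => hlm (Subtype.ext (hsep l l.2 m m.2 hlt))))
  have hCsum : ∀ (f : S0 d) (s : Finset Λ), ∑ l ∈ s, ‖c l * f l‖ ≤ ‖σ‖ * ‖φ‖ * (C * ‖f‖) :=
    fun f s => by
      refine le_trans (Finset.sum_le_sum fun l _ => ?_)
        ((Finset.mul_sum _ _ _).symm.le.trans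
          (mul_le_mul_of_nonneg_left (hC f s) (by positivity)))
      rw [norm_mul]
      exact mul_le_mul_of_nonneg_right (hcb l) (norm_nonneg _)
  have hsummable : ∀ f : S0 d, Summable fun l : Λ => ‖c l * f l‖ := fun f =>
    summable_of_sum_le (fun _ => norm_nonneg _) (hCsum f)
  have hcompact : ∀ f : S0 d, HasCompactSupport f → σ f = ∑' l : Λ, c l * f l := fun f hf => by
    have hfin : {l : Λ | (l : Rd d) ∈ tsupport f}.Finite :=
      ((finite_inter_lattice Λ hf).preimage Subtype.val_injective.injOn).subset
        fun l hl => ⟨hl, l.2⟩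
    have hs : ∀ l : Λ, l ∉ hfin.toFinset → f l = 0 := fun l hl =>
      image_eq_zero_of_notMem_tsupport (by simpa using hl)
    rw [tsum_eq_sum (s := hfin.toFinset) fun l hl => by rw [hs l hl, mul_zero]]
    -- Subtracting the interpolant of f on Λ leaves a compactly supported function that vanishes on
    -- Λ.
    have h0 : σ (f - ∑ l ∈ hfin.toFinset, f l • S0.translate l φ) = 0 := by
      refine apply_eq_zero_of_vanish_on_lattice hσ _ ?_ fun x hx => ?_
      · have hK : IsCompact (tsupport f ∪ ⋃ l ∈ hfin.toFinset, Metric.closedBall (l : Rd d) r) :=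
          hf.isCompact.union
            (hfin.toFinset.isCompact_biUnion fun l _ => isCompact_closedBall _ _)
        refine HasCompactSupport.intro hK fun x hx => ?_
        simp only [Set.mem_union, Set.mem_iUnion, not_or, not_exists, Metric.mem_closedBall,
          not_le] at hx
        rw [S0.sub_apply, S0.sum_apply, image_eq_zero_of_notMem_tsupport hx.1,
          Finset.sum_eq_zero fun l hl => ?_, sub_zero]
        rw [S0.smul_apply, S0.translate_apply, hφ, b.zero_of_le_dist, Complex.ofReal_zero,
          mul_zero]
        rw [dist_zero_right, ← dist_eq_norm]
        exact (hx.2 l hl).le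
      · simp only [S0.sub_apply, S0.sum_apply, S0.smul_apply, S0.translate_apply]
        rw [Finset.sum_congr rfl fun l _ => by rw [hφΛ x hx l l.2]]
        by_cases hxs : (⟨x, hx⟩ : Λ) ∈ hfin.toFinset
        · rw [Finset.sum_eq_single_of_mem _ hxs]
          · simp
          · intro l _ hl
            rw [if_neg fun h => hl (Subtype.ext h.symm), mul_zero]
        · rw [hs _ hxs, Finset.sum_eq_zero, sub_zero]
          intro l hl
          rw [if_neg fun h => hxs (by convert hl), mul_zero]
    rw [map_sub, sub_eq_zero, map_sum] at h0
    rw [h0]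
    exact Finset.sum_congr rfl fun l _ => by rw [map_smul, smul_eq_mul, mul_comm]
  refine ⟨c, ⟨_, hcb⟩, fun f => ?_⟩
  have hsum : σ f = ∑' l : Λ, c l * f l := by
    refine sub_eq_zero.1 (norm_le_zero_iff.1 (le_of_forall_pos_le_add fun ε hε => ?_))
    -- M bounds the norm of σ minus the comb; both agree on the compactly supported k, so only k - f
    -- contributes.
    set M := ‖σ‖ + ‖σ‖ * ‖φ‖ * C
    have hM : 0 ≤ M := by positivity
    obtain ⟨k, hk, hkf⟩ := f.exists_hasCompactSupport_norm_sub_lt (ε := ε / (M + 1))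
      (by positivity)
    have e : σ f - ∑' l : Λ, c l * f l = (∑' l : Λ, c l * (k - f) l) - σ (k - f) := by
      simp only [map_sub, S0.sub_apply, mul_sub]
      rw [(hsummable k).of_norm.tsum_sub (hsummable f).of_norm, hcompact k hk]
      ring
    have h1 : ‖∑' l : Λ, c l * (k - f) l‖ ≤ ‖σ‖ * ‖φ‖ * (C * ‖k - f‖) :=
      (norm_tsum_le_tsum_norm (hsummable _)).trans
        ((hsummable _).tsum_le_of_sum_le (hCsum _))
    have h2 : M * ‖k - f‖ ≤ M * (ε / (M + 1)) := mul_le_mul_of_nonneg_left hkf.le hM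
    have h3 : M * (ε / (M + 1)) ≤ ε := by
      rw [mul_div_assoc', div_le_iff₀ (by positivity)]
      nlinarith
    rw [e, zero_add]
    refine (norm_sub_le _ _).trans ((add_le_add h1 (σ.le_opNorm _)).trans ?_)
    refine le_trans (le_of_eq ?_) (h2.trans h3)
    simp only [M]
    ring
  rw [hsum]
  exact (hsummable f).of_norm.hasSum

lemma supp_subset_of_isWeightedDiracComb {σ : MildDistribution d} {c : Λ → ℂ}
    (h : IsWeightedDiracComb Λ c σ) : supp σ ⊆ (Λ : Set (Rd d)) := by
  refine Set.compl_subset_comm.1 fun z hz => ?_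
  obtain ⟨δ, hδ, hball⟩ := Metric.isOpen_iff.1 (isClosed_lattice Λ).isOpen_compl z hz
  refine ⟨δ, hδ, fun k hk => (h k).unique ?_⟩
  convert hasSum_zero with l
  rw [image_eq_zero_of_notMem_tsupport fun hl => hball (hk hl) l.2, mul_zero]

end Lattice

end Mild

end

theorem proposition4p1 (d : ℕ) (Λ : Submodule ℤ (Mild.Rd d)) [DiscreteTopology Λ]
    [IsZLattice ℝ Λ] (σ : Mild.MildDistribution d) :
    Mild.supp σ ⊆ (Λ : Set (Mild.Rd d)) ↔
      ∃ c : Λ → ℂ, (∃ C : ℝ, ∀ l : Λ, ‖c l‖ ≤ C) ∧ Mild.IsWeightedDiracComb Λ c σ :=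
  ⟨Mild.exists_weightedDiracComb, fun ⟨_, _, h⟩ => Mild.supp_subset_of_isWeightedDiracComb h⟩
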